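/- Let $K$ be a compact, connected, simply connected Lie group, $T\subseteq K$ a maximal torus, $K_{\mathbb C}$ and $\mathfrak k_{\mathbb C},\mathfrak t_{\mathbb C}$ the complexifications of $K$ and of the Lie algebras of $K$ and $T$. Fix a system $\Phi_+$ of positive roots of $(\mathfrak k_{\mathbb C},\mathfrak t_{\mathbb C})$ and let $B\subseteq K_{\mathbb C}$ be the corresponding Borel subgroup, i.e. the connected subgroup with Lie algebra $\mathfrak b=\mathfrak t_{\mathbb C}\oplus\bigoplus_{\alpha\in\Phi_+}\mathfrak k_\alpha$. Let $\sigma:K\to K$ be a continuous involutive group automorphism with $\sigma(t)=t^{-1}$ for all $t\in T$, and let $\hat\sigma:K_{\mathbb C}\to K_{\mathbb C}$ be its antiholomorphic extension. Let $L_{\rm alg}K_{\mathbb C}$ be the group of algebraic maps $\mathbb C^\times\to K_{\mathbb C}$, $L^+_{\rm alg}K_{\mathbb C}$ the subgroup of those maps that extend holomorphically to the interior of the unit disk, and $\mathcal B=\{\gamma\in L^+_{\rm alg}K_{\mathbb C}:\gamma(0)\in B\}$ the Iwahori subgroup. Let $\Omega_{\rm alg}K$ be the group of maps $\gamma:S^1\to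 K$ with $\gamma(1)=1$ that are restrictions of elements of $L_{\rm alg}K_{\mathbb C}$, with the topology induced by $H^1(S^1,K)$. For a coweight $\lambda\in X_*(T)=\mathrm{Hom}(S^1,T)$ (continuous homomorphisms), let $\mathcal B\lambda\subseteq\Omega_{\rm alg}K$ be its orbit under the action of $\mathcal B$ on $\Omega_{\rm alg}K= L_{\rm alg}K_{\mathbb C}/L^+_{\rm alg}K_{\mathbb C}$; that is, $\mathcal B\lambda$ consists of the $\gamma\in\Omega_{\rm alg}K$ of the form $\gamma=b\lambda p$ with $b\in\mathcal B$, $p\in L^+_{\rm alg}K_{\mathbb C}$. The affine Schubert variety of $\lambda$ is the closure $\overline{\mathcal B\lambda}$ in $\Omega_{\rm alg}K$. Put $(\tau\gamma)(z)=\sigma(\gamma(\bar z))$ for $\gamma\in\Omega_{\rm alg}K$, and $(\tau f)(z)=\hat\sigma(f(\bar z))$ for $f:\mathbb C^\times\to K_{\mathbb C}$. Then $\tau(\overline{\mathcal B\lambda})=\overline{\mathcal B\lambda}$ for every coweight $\lambda\in X_*(T)$. Moreover, $\hat\sigma(B)=B$ and $\tau(\mathcal B)=\mathcal B$, and every coweight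 $\lambda$ belongs to $\Omega_{\rm alg}K$ and satisfies $\tau\lambda=\lambda$. -/

import Mathlib

open scoped Manifold ContDiff ComplexConjugate Matrix Kronecker

noncomputable section

namespace LoopGroup

section RepresentativeFunctions

variable (K : Type*) [Group K] [TopologicalSpace K]

/-- `f : K → ℂ` is a representative function: a matrix coefficient `x ↦ ⟨u, ρ(x) v⟩` of a
continuous finite-dimensional complex representation `ρ` of `K`. -/
def IsRepresentative (f : K → ℂ) : Prop :=
  ∃ (n : ℕ) (ρ : K →* Matrix (Fin n) (Fin n) ℂ) (u v : Fin n → ℂ),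
    Continuous ρ ∧ ∀ x, f x = u ⬝ᵥ (ρ x *ᵥ v)

variable {K}

theorem IsRepresentative.of_fintype {ι : Type*} [Fintype ι] [DecidableEq ι] {f : K → ℂ}
    (ρ : K →* Matrix ι ι ℂ) (u v : ι → ℂ) (hρ : Continuous ρ)
    (hf : ∀ x, f x = u ⬝ᵥ (ρ x *ᵥ v)) : IsRepresentative K f := by
  let e := Fintype.equivFin ι
  refine ⟨Fintype.card ι, (Matrix.reindexAlgEquiv ℂ ℂ e).toAlgHom.toMonoidHom.comp ρ,
    u ∘ e.symm, v ∘ e.symm, ?_, fun x => ?_⟩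
  · exact hρ.matrix_reindex e e
  · rw [hf x]
    simp only [dotProduct, Matrix.mulVec]
    rw [← e.symm.sum_comp]
    refine Finset.sum_congr rfl fun i _ => ?_
    rw [← e.symm.sum_comp]
    rfl

theorem IsRepresentative.const (c : ℂ) : IsRepresentative K (fun _ => c) := by
  refine IsRepresentative.of_fintype (ι := Unit) 1 (fun _ => c) (fun _ => 1)
    continuous_const fun x => ?_
  simp [dotProduct]

theorem IsRepresentative.add {f g : K → ℂ} (hf : IsRepresentative K f)
    (hg : IsRepresentative K g) : IsRepresentative K (f + g) := by
  obtain ⟨n, ρ, u, v, hρ, hf⟩ := hf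
  obtain ⟨m, π, u', v', hπ, hg⟩ := hg
  let R : K →* Matrix (Fin n ⊕ Fin m) (Fin n ⊕ Fin m) ℂ :=
    { toFun := fun x => Matrix.fromBlocks (ρ x) 0 0 (π x)
      map_one' := by simp
      map_mul' := fun x y => by simp [Matrix.fromBlocks_multiply] }
  refine IsRepresentative.of_fintype R (Sum.elim u u') (Sum.elim v v') ?_ fun x => ?_
  · exact hρ.matrix_fromBlocks continuous_const continuous_const hπ
  · simp [R, hf x, hg x, Matrix.fromBlocks_mulVec, dotProduct, Fintype.sum_sum_type]

theorem IsRepresentative.mul {f g : K → ℂ} (hf : IsRepresentative K f)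
    (hg : IsRepresentative K g) : IsRepresentative K (f * g) := by
  obtain ⟨n, ρ, u, v, hρ, hf⟩ := hf
  obtain ⟨m, π, u', v', hπ, hg⟩ := hg
  let R : K →* Matrix (Fin n × Fin m) (Fin n × Fin m) ℂ :=
    { toFun := fun x => ρ x ⊗ₖ π x
      map_one' := by simp
      map_mul' := fun x y => by simp [Matrix.mul_kronecker_mul] }
  refine IsRepresentative.of_fintype R (fun p => u p.1 * u' p.2) (fun p => v p.1 * v' p.2)
    ?_ fun x => ?_
  · refine continuous_matrix fun i j => ?_
    exact (hρ.matrix_elem _ _).mul (hπ.matrix_elem _ _)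
  · simp only [Pi.mul_apply, hf x, hg x, dotProduct, Matrix.mulVec, Finset.sum_mul_sum,
      Fintype.sum_prod_type, R, MonoidHom.coe_mk, OneHom.coe_mk, Matrix.kroneckerMap_apply]
    refine Finset.sum_congr rfl fun i _ => Finset.sum_congr rfl fun j _ => ?_
    rw [mul_mul_mul_comm, Finset.sum_mul_sum]
    congr 1
    refine Finset.sum_congr rfl fun k _ => Finset.sum_congr rfl fun l _ => ?_
    ring

theorem IsRepresentative.conj {f : K → ℂ} (hf : IsRepresentative K f) :
    IsRepresentative K (fun x => conj (f x)) := by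
  obtain ⟨n, ρ, u, v, hρ, hf⟩ := hf
  let R : K →* Matrix (Fin n) (Fin n) ℂ := ((starRingEnd ℂ).mapMatrix.toMonoidHom).comp ρ
  refine ⟨n, R, fun i => conj (u i), fun i => conj (v i), ?_, fun x => ?_⟩
  · exact hρ.matrix_map Complex.continuous_conj
  · simp [R, hf x, dotProduct, Matrix.mulVec, map_sum]

theorem IsRepresentative.comp {f : K → ℂ} (hf : IsRepresentative K f) (σ : K →ₜ* K) :
    IsRepresentative K (fun x => f (σ x)) := by
  obtain ⟨n, ρ, u, v, hρ, hf⟩ := hf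
  exact ⟨n, ρ.comp σ.toMonoidHom, u, v, hρ.comp σ.continuous_toFun, fun x => hf (σ x)⟩

theorem IsRepresentative.left {f : K → ℂ} (hf : IsRepresentative K f) (a : K) :
    IsRepresentative K (fun x => f (a * x)) := by
  obtain ⟨n, ρ, u, v, hρ, hf⟩ := hf
  refine ⟨n, ρ, u ᵥ* ρ a, v, hρ, fun x => ?_⟩
  change f (a * x) = _
  rw [hf, map_mul, ← Matrix.mulVec_mulVec, Matrix.dotProduct_mulVec]

theorem continuous_rep_inv {n : ℕ} (ρ : K →* Matrix (Fin n) (Fin n) ℂ) (hρ : Continuous ρ) :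
    Continuous fun x => ρ x⁻¹ := by
  have h1 : ∀ x, ρ x * ρ x⁻¹ = 1 := fun x => by rw [← map_mul]; simp
  have h2 : ∀ x, (ρ x).det ≠ 0 := fun x h => by
    have := congrArg Matrix.det (h1 x)
    simp [Matrix.det_mul, h] at this
  have h3 : (fun x => ρ x⁻¹) = fun x => (ρ x).det⁻¹ • (ρ x).adjugate := by
    funext x
    have h4 := congrArg (fun M => (ρ x).adjugate * M) (h1 x)
    simp only [← mul_assoc, Matrix.adjugate_mul, Matrix.smul_mul, one_mul, mul_one] at h4
    rw [← h4, smul_smul, inv_mul_cancel₀ (h2 x), one_smul]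
  rw [h3]
  exact (hρ.matrix_det.inv₀ h2).smul hρ.matrix_adjugate

theorem IsRepresentative.inv {f : K → ℂ} (hf : IsRepresentative K f) :
    IsRepresentative K (fun x => f x⁻¹) := by
  obtain ⟨n, ρ, u, v, hρ, hf⟩ := hf
  let R : K →* Matrix (Fin n) (Fin n) ℂ :=
    { toFun := fun x => (ρ x⁻¹)ᵀ
      map_one' := by simp
      map_mul' := fun x y => by simp [Matrix.transpose_mul] }
  refine ⟨n, R, v, u, (continuous_rep_inv ρ hρ).matrix_transpose, fun x => ?_⟩
  change f x⁻¹ = v ⬝ᵥ (ρ x⁻¹)ᵀ *ᵥ u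
  rw [hf, Matrix.mulVec_transpose, dotProduct_comm v, Matrix.dotProduct_mulVec]

variable (K) in
/-- The algebra `R(K)` of complex-valued representative functions on `K`. -/
def repFun : Subalgebra ℂ (K → ℂ) where
  carrier := {f | IsRepresentative K f}
  mul_mem' := IsRepresentative.mul
  add_mem' := IsRepresentative.add
  algebraMap_mem' := fun c => IsRepresentative.const c

/-- Left translation `(L_a f)(y) = f (a y)` on `R(K)`. -/
def leftTranslate (a : K) : repFun K →ₐ[ℂ] repFun K where
  toFun f := ⟨fun y => f.1 (a * y), IsRepresentative.left f.2 a⟩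
  map_one' := rfl
  map_mul' _ _ := rfl
  map_zero' := rfl
  map_add' _ _ := rfl
  commutes' _ := rfl

/-- The antipode `f ↦ (x ↦ f x⁻¹)` of `R(K)`. -/
def antipode : repFun K →ₐ[ℂ] repFun K where
  toFun f := ⟨fun y => f.1 y⁻¹, IsRepresentative.inv f.2⟩
  map_one' := rfl
  map_mul' _ _ := rfl
  map_zero' := rfl
  map_add' _ _ := rfl
  commutes' _ := rfl

/-- The comultiplication of `R(K)`: every representative function satisfies
`f (x y) = ∑ j, a j x * b j y` with representative functions `a j`, `b j`. -/
theorem exists_comul (f : repFun K) : ∃ (n : ℕ) (a b : Fin n → repFun K),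
    ∀ x, leftTranslate x f = ∑ j, (a j).1 x • b j := by
  obtain ⟨f, n, ρ, u, v, hρ, hf⟩ := f
  refine ⟨n, fun j => ⟨fun x => (u ᵥ* ρ x) j, ⟨n, ρ, u, Pi.single j 1, hρ, fun x => ?_⟩⟩,
    fun j => ⟨fun y => (ρ y *ᵥ v) j, ⟨n, ρ, Pi.single j 1, v, hρ, fun x => ?_⟩⟩, fun x => ?_⟩
  · rw [Matrix.dotProduct_mulVec]; simp
  · simp
  · apply Subtype.ext
    funext y
    have : f (x * y) = ∑ j, (u ᵥ* ρ x) j * (ρ y *ᵥ v) j := by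
      rw [hf, map_mul, ← Matrix.mulVec_mulVec, Matrix.dotProduct_mulVec]; rfl
    change f (x * y) = _
    rw [this]
    simp [Finset.sum_apply]

end RepresentativeFunctions

section Complexification

variable (K : Type*) [Group K] [TopologicalSpace K]

/-- The complexification `K_ℂ` of the compact group `K`: the complex algebraic group with
coordinate ring `R(K)`, i.e. the group of algebra homomorphisms `R(K) → ℂ`. -/
def Complexification : Type _ := repFun K →ₐ[ℂ] ℂ

variable {K}

namespace Complexification

instance : FunLike (Complexification K) (repFun K) ℂ :=
  inferInstanceAs (FunLike (repFun K →ₐ[ℂ] ℂ) (repFun K) ℂ)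

instance : AlgHomClass (Complexification K) ℂ (repFun K) ℂ :=
  inferInstanceAs (AlgHomClass (repFun K →ₐ[ℂ] ℂ) ℂ (repFun K) ℂ)

@[ext] theorem ext {g h : Complexification K} (H : ∀ f, g f = h f) : g = h :=
  DFunLike.ext g h H

theorem isRepresentative_conv (g : Complexification K) (f : repFun K) :
    IsRepresentative K (fun x => g (leftTranslate x f)) := by
  obtain ⟨n, a, b, h⟩ := exists_comul f
  have : (fun x => g (leftTranslate x f)) = (∑ j, g (b j) • a j : repFun K).1 := by
    funext x
    rw [h x, map_sum]
    simp [Finset.sum_apply, mul_comm]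
  rw [this]
  exact (∑ j, g (b j) • a j : repFun K).2

/-- The action of `g ∈ K_ℂ` on `R(K)` by right translations, `(g ⋆ f)(x) = g (y ↦ f (x y))`. -/
def conv (g : Complexification K) : repFun K →ₐ[ℂ] repFun K where
  toFun f := ⟨fun x => g (leftTranslate x f), isRepresentative_conv g f⟩
  map_one' := by apply Subtype.ext; funext x; simp
  map_mul' f₁ f₂ := by apply Subtype.ext; funext x; simp
  map_zero' := by apply Subtype.ext; funext x; simp
  map_add' f₁ f₂ := by apply Subtype.ext; funext x; simp
  commutes' c := by
    apply Subtype.ext; funext x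
    change g (leftTranslate x (algebraMap ℂ _ c)) = c
    rw [AlgHom.commutes, AlgHomClass.commutes]
    rfl

/-- The product on `K_ℂ`: `(g h)(f) = g (x ↦ h (y ↦ f (x y)))`. -/
instance : Mul (Complexification K) := ⟨fun g h => AlgHom.comp (g : repFun K →ₐ[ℂ] ℂ) (conv h)⟩

/-- The unit of `K_ℂ`: evaluation at `1 ∈ K`. -/
instance : One (Complexification K) :=
  ⟨AlgHom.comp (Pi.evalAlgHom ℂ (fun _ : K => ℂ) 1) (repFun K).val⟩

/-- The inverse on `K_ℂ`: `g⁻¹(f) = g (x ↦ f x⁻¹)`. -/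
instance : Inv (Complexification K) := ⟨fun g => AlgHom.comp (g : repFun K →ₐ[ℂ] ℂ) antipode⟩

theorem mul_apply (g h : Complexification K) (f : repFun K) : (g * h) f = g (conv h f) := rfl

theorem one_apply (f : repFun K) : (1 : Complexification K) f = f.1 1 := rfl

theorem inv_apply (g : Complexification K) (f : repFun K) : g⁻¹ f = g (antipode f) := rfl

theorem conv_mul (g h : Complexification K) (f : repFun K) :
    conv (g * h) f = conv g (conv h f) := by
  apply Subtype.ext; funext x
  change g (conv h (leftTranslate x f)) = g (leftTranslate x (conv h f))
  congr 1
  apply Subtype.ext; funext y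
  change h (leftTranslate y (leftTranslate x f)) = h (leftTranslate (x * y) f)
  congr 1
  apply Subtype.ext; funext z
  change f.1 (x * (y * z)) = f.1 (x * y * z)
  rw [mul_assoc]

theorem conv_one (f : repFun K) : conv 1 f = f := by
  apply Subtype.ext; funext x
  change f.1 (x * 1) = f.1 x
  rw [mul_one]

theorem leftTranslate_one (f : repFun K) : leftTranslate 1 f = f := by
  apply Subtype.ext; funext x
  change f.1 (1 * x) = f.1 x
  rw [one_mul]

/-- In terms of the comultiplication: if `f (x y) = ∑ j, a j x * b j y`, then
`(g h)(f) = ∑ j, g (a j) * h (b j)`. -/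
theorem mul_apply_sum (f : repFun K) : ∃ (n : ℕ) (a b : Fin n → repFun K),
    ∀ g h : Complexification K, (g * h) f = ∑ j, g (a j) * h (b j) := by
  obtain ⟨n, a, b, H⟩ := exists_comul f
  refine ⟨n, a, b, fun g h => ?_⟩
  have : conv h f = ∑ j, h (b j) • a j := by
    apply Subtype.ext; funext x
    change h (leftTranslate x f) = _
    rw [H x, map_sum]
    simp [Finset.sum_apply, mul_comm]
  rw [mul_apply, this, map_sum]
  simp [mul_comm]

theorem inv_mul_self_apply (g : Complexification K) (f : repFun K) :
    (g⁻¹ * g) f = (1 : Complexification K) f := by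
  obtain ⟨n, a, b, H⟩ := exists_comul f
  have h1 : conv g f = ∑ j, g (b j) • a j := by
    apply Subtype.ext; funext x
    change g (leftTranslate x f) = _
    rw [H x, map_sum]
    simp [Finset.sum_apply, mul_comm]
  have h2 : ∑ j, b j * antipode (a j) = algebraMap ℂ (repFun K) (f.1 1) := by
    apply Subtype.ext; funext y
    have h3 := congrFun (congrArg Subtype.val (H y⁻¹)) y
    have h4 : f.1 (y⁻¹ * y) = ∑ j, (a j).1 y⁻¹ * (b j).1 y := by
      refine Eq.trans h3 ?_
      simp [Finset.sum_apply]
    rw [inv_mul_cancel] at h4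
    change _ = f.1 1
    rw [h4]
    have h5 : ∀ j, (antipode (a j)).1 y = (a j).1 y⁻¹ := fun _ => rfl
    simp only [AddSubmonoidClass.coe_finsetSum, Finset.sum_apply, Subalgebra.coe_mul, Pi.mul_apply]
    exact Finset.sum_congr rfl fun j _ => by rw [h5, mul_comm]
  rw [mul_apply, inv_apply, h1, one_apply]
  have h5 : antipode (∑ j, g (b j) • a j) = ∑ j, g (b j) • antipode (a j) := by
    simp [map_sum]
  rw [h5, map_sum]
  have h6 := congrArg g h2
  rw [map_sum, AlgHomClass.commutes] at h6
  simpa using h6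

instance : Group (Complexification K) where
  mul_assoc g₁ g₂ g₃ := by
    ext f
    rw [mul_apply, mul_apply, mul_apply, conv_mul]
  one_mul g := by
    ext f
    change g (leftTranslate 1 f) = g f
    rw [leftTranslate_one]
  mul_one g := by
    ext f
    rw [mul_apply, conv_one]
  inv_mul_cancel g := by
    ext f
    exact inv_mul_self_apply g f

end Complexification

/-- The canonical homomorphism `K → K_ℂ`, sending `x` to evaluation at `x`. -/
def toComplexification : K →* Complexification K where
  toFun x := AlgHom.comp (Pi.evalAlgHom ℂ (fun _ : K => ℂ) x) (repFun K).val
  map_one' := rfl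
  map_mul' _ _ := rfl

variable (K) in
/-- The Lie algebra `𝔨_ℂ` of `K_ℂ`: derivations of the coordinate ring `R(K)` that commute with
left translations, under the commutator bracket. -/
def complexLie : LieSubalgebra ℂ (Derivation ℂ (repFun K) (repFun K)) where
  carrier := {D | ∀ (a : K) (f : repFun K), D (leftTranslate a f) = leftTranslate a (D f)}
  add_mem' hD hE a f := by simp [hD a f, hE a f]
  zero_mem' a f := by simp
  smul_mem' c D hD a f := by simp [hD a f]
  lie_mem' {D E} hD hE a f := by simp [Derivation.commutator_apply, hD _ _, hE _ _]

/-- `g = exp D` for `g ∈ K_ℂ` and `D ∈ 𝔨_ℂ`: Taylor's formula `g(f) = ∑ₙ (Dⁿ f)(1) / n!` for every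
representative function `f`. -/
def IsExp (D : complexLie K) (g : Complexification K) : Prop :=
  ∀ f : repFun K, HasSum (fun n : ℕ => (n.factorial : ℂ)⁻¹ * ((D.1)^[n] f).1 1) (g f)

end Complexification

section Torus

variable {K : Type*} [Group K] [TopologicalSpace K]

/-- A torus in `K`: a subgroup isomorphic, as a topological group, to a power of the circle. -/
def IsTorus (T : Subgroup K) : Prop := ∃ n : ℕ, Nonempty (T ≃ₜ* (Fin n → Circle))

/-- A maximal torus of `K`. -/
def IsMaximalTorus (T : Subgroup K) : Prop :=
  IsTorus T ∧ ∀ T' : Subgroup K, IsTorus T' → T ≤ T' → T' = T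

/-- The complexified Lie algebra `𝔱_ℂ` of `T`, i.e. the Lie algebra of `T_ℂ` (the Zariski closure
of `T` in `K_ℂ`): the elements of `𝔨_ℂ` which preserve the ideal of functions vanishing on `T`. -/
def torusLie (T : Subgroup K) : LieSubalgebra ℂ (complexLie K) where
  carrier := {D | ∀ f : repFun K, (∀ t ∈ T, f.1 t = 0) → ∀ t ∈ T, (D.1 f).1 t = 0}
  add_mem' hD hE f hf t ht := by simp [hD f hf t ht, hE f hf t ht]
  zero_mem' f hf t ht := by simp
  smul_mem' c D hD f hf t ht := by simp [hD f hf t ht]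
  lie_mem' {D E} hD hE f hf t ht := by
    simp [Derivation.commutator_apply, hD _ (hE f hf) t ht, hE _ (hD f hf) t ht]

/-- The weight space `{X ∈ 𝔨_ℂ | [H, X] = α(H) X for all H ∈ 𝔱_ℂ}`. -/
def rootSpace (T : Subgroup K) (α : Module.Dual ℂ (torusLie T)) :
    Submodule ℂ (complexLie K) where
  carrier := {X | ∀ H : torusLie T, ⁅(H : complexLie K), X⁆ = α H • X}
  add_mem' hX hY H := by rw [lie_add, hX H, hY H, smul_add]
  zero_mem' H := by simp
  smul_mem' c X hX H := by rw [lie_smul, hX H, smul_comm]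

/-- The root system `Φ` of `(𝔨_ℂ, 𝔱_ℂ)`. -/
def roots (T : Subgroup K) : Set (Module.Dual ℂ (torusLie T)) :=
  {α | α ≠ 0 ∧ rootSpace T α ≠ ⊥}

/-- `P` is a system of positive roots `Φ₊`: it contains exactly one of `α`, `-α` for each root `α`,
and it is closed under those sums that are roots. -/
structure IsPositiveSystem (T : Subgroup K) (P : Set (Module.Dual ℂ (torusLie T))) : Prop where
  subset_roots : P ⊆ roots T
  mem_or_neg_mem : ∀ α ∈ roots T, α ∈ P ∨ -α ∈ P
  not_neg_mem : ∀ α ∈ P, -α ∉ P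
  add_mem : ∀ α ∈ P, ∀ β ∈ P, α + β ∈ roots T → α + β ∈ P

/-- `𝔟 = 𝔱_ℂ ⊕ ⨁_{α ∈ Φ₊} 𝔨_α`. -/
def borelLie (T : Subgroup K) (P : Set (Module.Dual ℂ (torusLie T))) :
    Submodule ℂ (complexLie K) :=
  (torusLie T).toSubmodule ⊔ ⨆ α ∈ P, rootSpace T α

/-- The Borel subgroup `B ⊆ K_ℂ` attached to `T` and `Φ₊`: the connected subgroup with Lie
algebra `𝔟`, i.e. the subgroup generated by `exp 𝔟`. -/
def borel (T : Subgroup K) (P : Set (Module.Dual ℂ (torusLie T))) :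
    Subgroup (Complexification K) :=
  Subgroup.closure {g | ∃ D ∈ borelLie T P, IsExp D g}

end Torus

section Loops

/-- The algebra `ℂ[z, z⁻¹]` of regular functions on `ℂˣ`. -/
def regularFun : Subalgebra ℂ (ℂˣ → ℂ) :=
  Algebra.adjoin ℂ {fun z : ℂˣ => (z : ℂ), fun z : ℂˣ => ((z⁻¹ : ℂˣ) : ℂ)}

theorem regularFun_conj {p : ℂˣ → ℂ} (hp : p ∈ regularFun) :
    (fun z => conj (p (star z))) ∈ regularFun := by
  induction hp using Algebra.adjoin_induction with
  | mem p hp =>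
    rcases hp with rfl | rfl
    · exact Algebra.subset_adjoin (Or.inl (by funext z; simp))
    · exact Algebra.subset_adjoin (Or.inr (by funext z; simp))
  | algebraMap c => exact regularFun.algebraMap_mem (conj c)
  | add p q _ _ hp hq =>
    simp only [Pi.add_apply, map_add]
    exact regularFun.add_mem hp hq
  | mul p q _ _ hp hq =>
    simp only [Pi.mul_apply, map_mul]
    exact regularFun.mul_mem hp hq

variable (K : Type*) [Group K] [TopologicalSpace K]

/-- `L_alg K_ℂ`: the group of algebraic maps `ℂˣ → K_ℂ`, that is, of those maps which pull regular
functions on `K_ℂ` back to regular functions on `ℂˣ`. -/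
def algMaps : Subgroup (ℂˣ → Complexification K) where
  carrier := {f | ∀ r : repFun K, (fun z => f z r) ∈ regularFun}
  one_mem' r := regularFun.algebraMap_mem (r.1 1)
  mul_mem' {f g} hf hg r := by
    obtain ⟨n, a, b, H⟩ := Complexification.mul_apply_sum r
    have : (fun z => (f * g) z r) = ∑ j, (fun z => f z (a j)) * (fun z => g z (b j)) := by
      funext z
      simp [H, Finset.sum_apply]
    rw [this]
    exact regularFun.sum_mem fun j _ => regularFun.mul_mem (hf _) (hg _)
  inv_mem' {f} hf r := hf (antipode r)

variable {K}

/-- `F` extends `f : ℂˣ → K_ℂ` to a map `ℂ → K_ℂ` that is holomorphic on the open unit disk. -/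
def IsDiskExtension (f : ℂˣ → Complexification K) (F : ℂ → Complexification K) : Prop :=
  (∀ z : ℂˣ, F z = f z) ∧
    ∀ r : repFun K, DifferentiableOn ℂ (fun z => F z r) (Metric.ball 0 1)

theorem IsDiskExtension.one :
    IsDiskExtension (1 : ℂˣ → Complexification K) (1 : ℂ → Complexification K) :=
  ⟨fun _ => rfl, fun _ => differentiableOn_const _⟩

theorem IsDiskExtension.mul {f g : ℂˣ → Complexification K} {F G : ℂ → Complexification K}
    (hf : IsDiskExtension f F) (hg : IsDiskExtension g G) : IsDiskExtension (f * g) (F * G) := by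
  refine ⟨fun z => by simp [hf.1 z, hg.1 z], fun r => ?_⟩
  obtain ⟨n, a, b, H⟩ := Complexification.mul_apply_sum r
  have : (fun z => (F * G) z r) = fun z => ∑ j, F z (a j) * G z (b j) := by
    funext z
    simp [H]
  rw [this]
  exact DifferentiableOn.fun_sum fun j _ => (hf.2 _).mul (hg.2 _)

theorem IsDiskExtension.inv {f : ℂˣ → Complexification K} {F : ℂ → Complexification K}
    (hf : IsDiskExtension f F) : IsDiskExtension f⁻¹ F⁻¹ :=
  ⟨fun z => by simp [hf.1 z], fun r => hf.2 (antipode r)⟩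

variable (K) in
/-- `L⁺_alg K_ℂ`: the algebraic maps that extend holomorphically to the interior of the unit
disk. -/
def posMaps : Subgroup (ℂˣ → Complexification K) where
  carrier := {f | f ∈ algMaps K ∧ ∃ F, IsDiskExtension f F}
  one_mem' := ⟨one_mem _, 1, IsDiskExtension.one⟩
  mul_mem' := fun ⟨hf, F, hF⟩ ⟨hg, G, hG⟩ => ⟨mul_mem hf hg, F * G, hF.mul hG⟩
  inv_mem' := fun ⟨hf, F, hF⟩ => ⟨inv_mem hf, F⁻¹, hF.inv⟩

/-- The preimage of a subgroup `B ⊆ K_ℂ` under `ev₀ : L⁺_alg K_ℂ → K_ℂ`, `γ ↦ γ(0)`. For a Borel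
subgroup `B` this is the Iwahori subgroup `ℬ`. -/
def iwahori (B : Subgroup (Complexification K)) : Subgroup (ℂˣ → Complexification K) where
  carrier := {f | f ∈ algMaps K ∧ ∃ F, IsDiskExtension f F ∧ F 0 ∈ B}
  one_mem' := ⟨one_mem _, 1, IsDiskExtension.one, one_mem B⟩
  mul_mem' := fun ⟨hf, F, hF, hF0⟩ ⟨hg, G, hG, hG0⟩ =>
    ⟨mul_mem hf hg, F * G, hF.mul hG, mul_mem hF0 hG0⟩
  inv_mem' := fun ⟨hf, F, hF, hF0⟩ => ⟨inv_mem hf, F⁻¹, hF.inv, inv_mem hF0⟩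

/-- The loop `γ : S¹ → K` is the restriction to `S¹` of the map `f : ℂˣ → K_ℂ`. -/
def IsRestriction (γ : Circle → K) (f : ℂˣ → Complexification K) : Prop :=
  ∀ z : Circle, f (Circle.toUnits z) = toComplexification (γ z)

variable (K) in
/-- `Ω_alg K`: the group of based loops in `K` that are restrictions of algebraic maps
`ℂˣ → K_ℂ`. -/
def algLoops : Subgroup (Circle → K) where
  carrier := {γ | γ 1 = 1 ∧ ∃ f ∈ algMaps K, IsRestriction γ f}
  one_mem' := ⟨rfl, 1, one_mem _, fun z => by simp⟩
  mul_mem' := fun ⟨h1, f, hf, hγ⟩ ⟨h2, g, hg, hδ⟩ =>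
    ⟨by simp [h1, h2], f * g, mul_mem hf hg, fun z => by
      rw [Pi.mul_apply, Pi.mul_apply, hγ z, hδ z, map_mul]⟩
  inv_mem' := fun ⟨h1, f, hf, hγ⟩ =>
    ⟨by simp [h1], f⁻¹, inv_mem hf, fun z => by
      rw [Pi.inv_apply, Pi.inv_apply, hγ z, map_inv]⟩

/-- The `H¹` distance `(∫₀^{2π} |u - v|² + |u' - v'|² dθ)^{1/2}` of two functions on the circle. -/
def h1Dist (u v : Circle → ℂ) : ℝ :=
  √(∫ θ in (0 : ℝ)..(2 * Real.pi), (‖u (Circle.exp θ) - v (Circle.exp θ)‖ ^ 2 +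
    ‖deriv (fun s : ℝ => u (Circle.exp s)) θ - deriv (fun s : ℝ => v (Circle.exp s)) θ‖ ^ 2))

/-- The topology on `Ω_alg K` as a subset of `ΩK = {γ ∈ H¹(S¹, K) | γ(1) = 1}`: the coarsest one
for which the balls of the `H¹` pseudo-distances `(γ, η) ↦ ‖r ∘ γ - r ∘ η‖_{H¹}`, `r ∈ R(K)`, are
open. For a faithful unitary representation of `K` on `ℂⁿ`, it is the topology of the
`H¹` distance of matrix-valued functions. -/
instance : TopologicalSpace (algLoops K) :=
  TopologicalSpace.generateFrom
    {U | ∃ (r : repFun K) (γ₀ : algLoops K) (ε : ℝ),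
      U = {γ | h1Dist (fun z => r.1 (γ.1 z)) (fun z => r.1 (γ₀.1 z)) < ε}}

/-- The Bruhat cell `ℬλ ⊆ Ω_alg K` of a coweight `λ : S¹ → T`: the orbit of `λ` under `ℬ`, where
`L_alg K_ℂ` acts on `Ω_alg K = L_alg K_ℂ / L⁺_alg K_ℂ`. Thus `γ ∈ ℬλ` if and only if `γ = b λ p` in
`L_alg K_ℂ` with `b ∈ ℬ` and `p ∈ L⁺_alg K_ℂ`. -/
def bruhatCell {T : Subgroup K} (B : Subgroup (Complexification K)) (cow : Circle →ₜ* T) :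
    Set (algLoops K) :=
  {γ | ∃ f ∈ algMaps K, ∃ l ∈ algMaps K, ∃ b ∈ iwahori B, ∃ p ∈ posMaps K,
    IsRestriction γ.1 f ∧ IsRestriction (fun z => (cow z : K)) l ∧ f = b * l * p}

/-- The affine Schubert variety: the closure of the Bruhat cell `ℬλ` in `Ω_alg K`. -/
def schubertVariety {T : Subgroup K} (B : Subgroup (Complexification K)) (cow : Circle →ₜ* T) :
    Set (algLoops K) :=
  closure (bruhatCell B cow)

end Loops

section Involution

variable {K : Type*} [Group K] [TopologicalSpace K]

/-- For a continuous endomorphism `σ` of `K`, the conjugate-linear ring endomorphism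
`f ↦ conj ∘ f ∘ σ` of `R(K)`. -/
def conjPullback (σ : K →ₜ* K) : repFun K →+* repFun K where
  toFun f := ⟨fun x => conj (f.1 (σ x)), (IsRepresentative.comp f.2 σ).conj⟩
  map_one' := by apply Subtype.ext; funext x; simp
  map_mul' f g := by apply Subtype.ext; funext x; simp
  map_zero' := by apply Subtype.ext; funext x; simp
  map_add' f g := by apply Subtype.ext; funext x; simp

/-- The antiholomorphic extension of `σ` to `K_ℂ`. -/
def complexSigma (σ : K →ₜ* K) (g : Complexification K) : Complexification K :=
  ({ ((starRingEnd ℂ).comp ((g : repFun K →ₐ[ℂ] ℂ) : repFun K →+* ℂ)).comp (conjPullback σ) with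
     commutes' := fun c => by
      change conj (g (conjPullback σ (algebraMap ℂ _ c))) = c
      have : conjPullback σ (algebraMap ℂ _ c) = algebraMap ℂ _ (conj c) := by
        apply Subtype.ext; funext x; rfl
      rw [this, AlgHomClass.commutes]
      simp } : repFun K →ₐ[ℂ] ℂ)

theorem complexSigma_apply (σ : K →ₜ* K) (g : Complexification K) (f : repFun K) :
    complexSigma σ g f = conj (g (conjPullback σ f)) := rfl

theorem complexSigma_toComplexification (σ : K →ₜ* K) (x : K) :
    complexSigma σ (toComplexification x) = toComplexification (σ x) := by
  ext f
  change conj (conj (f.1 (σ x))) = f.1 (σ x)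
  simp

/-- The extension of `τ` to maps `f : ℂˣ → K_ℂ`, `(τ f)(z) = σ(f(conj z))`. -/
def complexTau (σ : K →ₜ* K) (f : ℂˣ → Complexification K) : ℂˣ → Complexification K :=
  fun z => complexSigma σ (f (star z))

theorem complexTau_mem (σ : K →ₜ* K) {f : ℂˣ → Complexification K} (hf : f ∈ algMaps K) :
    complexTau σ f ∈ algMaps K :=
  fun r => regularFun_conj (hf (conjPullback σ r))

/-- The involution `(τ γ)(z) = σ(γ(conj z))` of `Ω_alg K`; here `conj z = z⁻¹` since `z ∈ S¹`. -/
def tau (σ : K →ₜ* K) (γ : algLoops K) : algLoops K :=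
  ⟨fun z => σ (γ.1 z⁻¹), by
    obtain ⟨γ, h1, f, hf, hγ⟩ := γ
    refine ⟨by simp [h1], complexTau σ f, complexTau_mem σ hf, fun z => ?_⟩
    have hz : star (Circle.toUnits z) = Circle.toUnits z⁻¹ := by
      apply Units.ext
      exact (Circle.coe_inv_eq_conj z).symm
    rw [complexTau, hz, hγ, complexSigma_toComplexification]⟩

end Involution

end LoopGroup

end

/-! Everything rests on two inversions cancelling. On `T` the involution is `t ↦ t⁻¹`, while a
character `χ` of the compact group `T` is unimodular, so complex conjugation inverts its values:
`conj (χ t⁻¹) = χ t`. Hence `f ↦ conj ∘ f ∘ σ` preserves every weight space of `R(K)` under right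
translation by `T` (`conjPullback_mem_weightSpace`), and these spaces span `R(K)` because continuous
representations of compact abelian groups are diagonalizable (`iSup_weightSpace_eq_top`).

An element `H` of `𝔱_ℂ` acts on each weight space by a scalar, and `σ H` acts there by the conjugate
scalar. A root vector for `α` shifts eigenvalues of `H` by `α(H)`, so `α(σ H) = conj (α(H))`
(`root_lieSigma`). The antilinear involution of `𝔨_ℂ` therefore maps each root space to itself,
hence preserves `𝔟` and, through the exponential, `B` (`complexSigma_mem_borel`).

For loops, `z ↦ conj z` combined with the antiholomorphic involution of `K_ℂ` respects algebraicity
and holomorphy on the disk, and `0` is fixed, so `τ` preserves `L⁺` and the Iwahori subgroup. A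
coweight satisfies `σ(λ(z⁻¹)) = λ(z⁻¹)⁻¹ = λ(z)`. Applying `τ` to `b λ p` thus stays in the cell of
`λ`, and `τ` is an `H¹` isometry up to relabelling `r ∈ R(K)`, so it is continuous and passes to the
closure.

That coweights are algebraic loops comes from the same weight decomposition: on a weight vector the
pullback along `λ` is a multiple of some `zⁿ`. -/

noncomputable section

namespace LoopGroup

/-! ### Diagonalizability of representations of compact abelian groups. -/

section Diagonalization

theorem norm_le_one_of_pow_bounded {μ : ℂ} {a C : ℝ} (ha : 0 < a)
    (h : ∀ k : ℕ, ‖μ‖ ^ k * a ≤ C) : ‖μ‖ ≤ 1 := by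
  by_contra! hμ
  obtain ⟨k, hk⟩ := pow_unbounded_of_one_lt (C / a) hμ
  rw [div_lt_iff₀ ha] at hk
  exact absurd (h k) (not_le.mpr hk)

theorem pow_mulVec_of_eigenvector {G : Type*} [Group G] {n : ℕ}
    (ρ : G →* Matrix (Fin n) (Fin n) ℂ) {t : G} {μ : ℂ}
    {w : Fin n → ℂ} (hw : ρ t *ᵥ w = μ • w) (k : ℕ) : ρ (t ^ k) *ᵥ w = μ ^ k • w := by
  induction k with
  | zero => simp
  | succ k ih =>
    rw [pow_succ, map_mul, ← Matrix.mulVec_mulVec, hw, Matrix.mulVec_smul, ih, smul_smul, pow_succ,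
      mul_comm]

variable {G : Type*} [Group G] [TopologicalSpace G] [CompactSpace G] {n : ℕ}

theorem exists_norm_mulVec_le (ρ : G →* Matrix (Fin n) (Fin n) ℂ) (hρ : Continuous ρ)
    (v : Fin n → ℂ) : ∃ C, ∀ t, ‖ρ t *ᵥ v‖ ≤ C := by
  have hc : Continuous fun t => ρ t *ᵥ v := hρ.matrix_mulVec continuous_const
  obtain ⟨C, hC⟩ := isCompact_univ.exists_bound_of_continuousOn hc.continuousOn
  exact ⟨C, fun t => hC t (Set.mem_univ t)⟩

theorem norm_eigenvalue_le_one (ρ : G →* Matrix (Fin n) (Fin n) ℂ) (hρ : Continuous ρ) {t : G}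
    {μ : ℂ} {w : Fin n → ℂ} (hw0 : w ≠ 0) (hw : ρ t *ᵥ w = μ • w) : ‖μ‖ ≤ 1 := by
  obtain ⟨C, hC⟩ := exists_norm_mulVec_le ρ hρ w
  refine norm_le_one_of_pow_bounded (norm_pos_iff.mpr hw0) (C := C) fun k => ?_
  rw [← norm_pow, ← norm_smul, ← pow_mulVec_of_eigenvector ρ hw]
  exact hC _

/-- The eigenvalues of a continuous representation of a compact group are unimodular. -/
theorem norm_eigenvalue (ρ : G →* Matrix (Fin n) (Fin n) ℂ) (hρ : Continuous ρ) {t : G}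
    {μ : ℂ} {w : Fin n → ℂ} (hw0 : w ≠ 0) (hw : ρ t *ᵥ w = μ • w) : ‖μ‖ = 1 := by
  refine le_antisymm (norm_eigenvalue_le_one ρ hρ hw0 hw) ?_
  -- The lower bound is the upper bound for `t⁻¹`, which has eigenvalue `μ⁻¹` on `w`.
  have h1 : w = μ • ρ t⁻¹ *ᵥ w := by
    rw [← Matrix.mulVec_smul, ← hw, Matrix.mulVec_mulVec, ← map_mul]
    simp
  have hμ : μ ≠ 0 := by
    rintro rfl
    exact hw0 (by rw [h1, zero_smul])
  have h2 : ρ t⁻¹ *ᵥ w = μ⁻¹ • w := by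
    conv_rhs => rw [h1]
    rw [smul_smul, inv_mul_cancel₀ hμ, one_smul]
  have h3 := norm_eigenvalue_le_one ρ hρ hw0 h2
  rw [norm_inv] at h3
  exact (inv_le_one₀ (norm_pos_iff.mpr hμ)).mp h3

/-- A continuous representation of a compact group has no nontrivial Jordan blocks. -/
theorem eigenvector_of_jordan (ρ : G →* Matrix (Fin n) (Fin n) ℂ) (hρ : Continuous ρ) {t : G}
    {μ : ℂ} {v w : Fin n → ℂ} (hv : ρ t *ᵥ v = μ • v + w) (hw : ρ t *ᵥ w = μ • w) : w = 0 := by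
  by_contra hw0
  have hμ := norm_eigenvalue ρ hρ hw0 hw
  -- This is `ρ(t)ᵏ v = μᵏ v + k μᵏ⁻¹ w` multiplied by `μ` to avoid the exponent `k - 1`. As `‖μ‖ =
  -- 1`, the last term grows linearly in `k` unless `w = 0`, against the boundedness of the orbit of
  -- `v`.
  have hpow : ∀ k : ℕ, μ • ρ (t ^ k) *ᵥ v = μ ^ (k + 1) • v + ((k : ℂ) * μ ^ k) • w := by
    intro k
    induction k with
    | zero => simp
    | succ k ih =>
      rw [pow_succ, map_mul, ← Matrix.mulVec_mulVec, hv, Matrix.mulVec_add, Matrix.mulVec_smul, ih,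
        pow_mulVec_of_eigenvector ρ hw]
      push_cast
      module
  obtain ⟨C, hC⟩ := exists_norm_mulVec_le ρ hρ v
  have hbound : ∀ k : ℕ, (k : ℝ) * ‖w‖ ≤ C + ‖v‖ := by
    intro k
    have h1 : ((k : ℂ) * μ ^ k) • w = μ • ρ (t ^ k) *ᵥ v - μ ^ (k + 1) • v := by
      rw [hpow]; abel
    have h2 := congrArg norm h1
    rw [norm_smul, norm_mul, norm_pow, hμ, one_pow, mul_one, Complex.norm_natCast] at h2
    rw [h2]
    refine (norm_sub_le _ _).trans ?_
    rw [norm_smul, norm_smul, norm_pow, hμ]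
    simpa using hC (t ^ k)
  obtain ⟨k, hk⟩ := exists_nat_gt ((C + ‖v‖) / ‖w‖)
  rw [div_lt_iff₀ (norm_pos_iff.mpr hw0)] at hk
  exact absurd (hbound k) (not_le.mpr hk)

/-- A longer Jordan chain contains one of length two, which `eigenvector_of_jordan` excludes;
induction on the exponent reduces to that case. -/
theorem maxGenEigenspace_le_eigenspace (ρ : G →* Matrix (Fin n) (Fin n) ℂ) (hρ : Continuous ρ)
    (t : G) (μ : ℂ) :
    Module.End.maxGenEigenspace (Matrix.toLin' (ρ t)) μ ≤
      Module.End.eigenspace (Matrix.toLin' (ρ t)) μ := by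
  intro v hv
  rw [Module.End.mem_maxGenEigenspace] at hv
  obtain ⟨k, hk⟩ := hv
  rw [Module.End.mem_eigenspace_iff, ← sub_eq_zero]
  set N : Module.End ℂ (Fin n → ℂ) := Matrix.toLin' (ρ t) - μ • 1 with hN
  have hN' : ∀ u, N u = ρ t *ᵥ u - μ • u := fun u => by simp [hN, Matrix.toLin'_apply]
  have key : ∀ (k : ℕ) (u : Fin n → ℂ), (N ^ k) u = 0 → N u = 0 := by
    intro k
    induction k with
    | zero => intro u hu; simp at hu; simp [hu]
    | succ k ih =>
      intro u hu
      have h1 : N (N u) = 0 := ih (N u) (by rw [pow_succ] at hu; exact hu)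
      refine eigenvector_of_jordan ρ hρ (t := t) (μ := μ) (v := u) ?_ ?_
      · rw [hN']; abel
      · rw [hN'] at h1; exact sub_eq_zero.mp h1
  have := key k v hk
  rwa [hN'] at this

/-- Continuous representations of compact abelian groups are simultaneously diagonalizable. -/
theorem iSup_iInf_eigenspace_eq_top (hG : ∀ a b : G, a * b = b * a)
    (ρ : G →* Matrix (Fin n) (Fin n) ℂ) (hρ : Continuous ρ) :
    ⨆ χ : G → ℂ, ⨅ t, Module.End.eigenspace (Matrix.toLin' (ρ t)) (χ t) = ⊤ := by
  have h := Module.End.iSup_iInf_maxGenEigenspace_eq_top_of_iSup_maxGenEigenspace_eq_top_of_commute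
    (fun t => Matrix.toLin' (ρ t)) (fun s t _ => by
      change Matrix.toLin' (ρ s) * Matrix.toLin' (ρ t) = Matrix.toLin' (ρ t) * Matrix.toLin' (ρ s)
      rw [Module.End.mul_eq_comp, Module.End.mul_eq_comp, ← Matrix.toLin'_mul, ← Matrix.toLin'_mul, ← map_mul, ← map_mul, hG])
    (fun t => Module.End.iSup_maxGenEigenspace_eq_top _)
  rw [eq_top_iff, ← h]
  exact iSup_mono fun χ => iInf_mono fun t => maxGenEigenspace_le_eigenspace ρ hρ t (χ t)

end Diagonalization

/-! ### Weight decomposition of the representative functions. -/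

section Weights

variable {K G : Type*} [Group K] [TopologicalSpace K] [Group G]

theorem IsRepresentative.continuous {f : K → ℂ} (hf : IsRepresentative K f) : Continuous f := by
  obtain ⟨n, ρ, u, v, hρ, hf⟩ := hf
  rw [funext hf]
  exact continuous_const.dotProduct (hρ.matrix_mulVec continuous_const)

/-- The weight space `{f ∈ R(K) | f (x φ(t)) = χ(t) f(x)}` of a homomorphism `φ : G → K`. -/
def weightSpace (φ : G →* K) (χ : G → ℂ) : Submodule ℂ (repFun K) where
  carrier := {f | ∀ x t, f.1 (x * φ t) = χ t * f.1 x}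
  add_mem' {f g} hf hg x t := by simp [hf x t, hg x t, mul_add]
  zero_mem' x t := by simp
  smul_mem' c f hf x t := by simp [hf x t, mul_left_comm]

variable {φ : G →* K} {χ : G → ℂ} {f : repFun K}

/-- The definition of a weight space allows an arbitrary function `χ`; a single nonzero weight
vector forces it to be a character. -/
theorem weight_mul (hf : f ∈ weightSpace φ χ) (hf0 : f ≠ 0) (s t : G) :
    χ (s * t) = χ s * χ t := by
  obtain ⟨x, hx⟩ : ∃ x, f.1 x ≠ 0 := by
    by_contra! h
    exact hf0 (Subtype.ext (funext h))
  refine mul_right_cancel₀ hx ?_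
  rw [← hf, map_mul, ← mul_assoc, hf, hf]
  ring

theorem weight_one (hf : f ∈ weightSpace φ χ) (hf0 : f ≠ 0) : χ 1 = 1 := by
  obtain ⟨x, hx⟩ : ∃ x, f.1 x ≠ 0 := by
    by_contra! h
    exact hf0 (Subtype.ext (funext h))
  refine mul_right_cancel₀ hx ?_
  rw [← hf, map_one, mul_one, one_mul]

variable [TopologicalSpace G]

theorem continuous_weight [ContinuousMul K] (hφ : Continuous φ) (hf : f ∈ weightSpace φ χ)
    (hf0 : f ≠ 0) : Continuous χ := by
  obtain ⟨x, hx⟩ : ∃ x, f.1 x ≠ 0 := by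
    by_contra! h
    exact hf0 (Subtype.ext (funext h))
  have : χ = fun t => f.1 (x * φ t) / f.1 x := by
    funext t
    rw [hf, mul_div_cancel_right₀ _ hx]
  rw [this]
  exact (f.2.continuous.comp (continuous_const.mul hφ)).div_const _

variable [CompactSpace G]

/-- The powers `χ(s)ᵏ = χ(sᵏ)` are bounded by compactness, so `‖χ s‖ ≤ 1`; using this for both `t`
and `t⁻¹` gives equality. -/
theorem norm_weight [ContinuousMul K] (hφ : Continuous φ) (hf : f ∈ weightSpace φ χ)
    (hf0 : f ≠ 0) (t : G) : ‖χ t‖ = 1 := by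
  obtain ⟨C, hC⟩ := isCompact_univ.exists_bound_of_continuousOn
    (continuous_weight hφ hf hf0).continuousOn
  have hpow : ∀ (s : G) (k : ℕ), χ (s ^ k) = χ s ^ k := by
    intro s k
    induction k with
    | zero => simpa using weight_one hf hf0
    | succ k ih => rw [pow_succ, weight_mul hf hf0, ih, pow_succ]
  have hle : ∀ s, ‖χ s‖ ≤ 1 := fun s =>
    norm_le_one_of_pow_bounded one_pos (C := C) fun k => by
      rw [mul_one, ← norm_pow, ← hpow]
      exact hC _ (Set.mem_univ _)
  refine le_antisymm (hle t) ?_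
  have h1 : χ t * χ t⁻¹ = 1 := by rw [← weight_mul hf hf0, mul_inv_cancel, weight_one hf hf0]
  calc (1 : ℝ) = ‖χ t‖ * ‖χ t⁻¹‖ := by rw [← norm_mul, h1, norm_one]
    _ ≤ ‖χ t‖ := mul_le_of_le_one_right (norm_nonneg _) (hle _)

/-- `R(K)` is spanned by its weight vectors for a compact abelian group. -/
theorem iSup_weightSpace_eq_top (hG : ∀ a b : G, a * b = b * a) (hφ : Continuous φ) :
    ⨆ χ : G → ℂ, weightSpace φ χ = ⊤ := by
  rw [eq_top_iff]
  rintro ⟨f, n, ρ, u, v, hρ, hf⟩ -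
  -- With `u` fixed, the matrix coefficient is linear in the vector and sends simultaneous
  -- eigenvectors of `ρ ∘ φ` to weight vectors.
  let coeff : (Fin n → ℂ) →ₗ[ℂ] repFun K :=
    { toFun := fun w => ⟨fun x => u ⬝ᵥ (ρ x *ᵥ w), n, ρ, u, w, hρ, fun _ => rfl⟩
      map_add' := fun w w' => by
        apply Subtype.ext; funext x
        simp [Matrix.mulVec_add, dotProduct_add]
      map_smul' := fun c w => by
        apply Subtype.ext; funext x
        simp [Matrix.mulVec_smul] }
  have hv : v ∈ ⨆ χ : G → ℂ, ⨅ t, Module.End.eigenspace (Matrix.toLin' (ρ (φ t))) (χ t) := by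
    have := iSup_iInf_eigenspace_eq_top hG (ρ.comp φ) (hρ.comp hφ)
    exact this ▸ Submodule.mem_top
  have hmem : coeff v ∈ ⨆ χ : G → ℂ, weightSpace φ χ := by
    have := Submodule.mem_map_of_mem (f := coeff) hv
    rw [Submodule.map_iSup] at this
    have hle : ⨆ χ : G → ℂ, Submodule.map coeff
        (⨅ t, Module.End.eigenspace (Matrix.toLin' (ρ (φ t))) (χ t)) ≤
        ⨆ χ : G → ℂ, weightSpace φ χ := iSup_mono fun χ => ?_
    · exact hle this
    rintro _ ⟨w, hw, rfl⟩ x t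
    simp only [SetLike.mem_coe, Submodule.mem_iInf, Module.End.mem_eigenspace_iff,
      Matrix.toLin'_apply] at hw
    change u ⬝ᵥ (ρ (x * φ t) *ᵥ w) = χ t * (u ⬝ᵥ (ρ x *ᵥ w))
    rw [map_mul, ← Matrix.mulVec_mulVec, hw, Matrix.mulVec_smul, dotProduct_smul, smul_eq_mul]
  have : (⟨f, n, ρ, u, v, hρ, hf⟩ : repFun K) = coeff v := Subtype.ext (funext hf)
  rwa [this]

end Weights

/-! ### The involution on the complexified Lie algebra and group. -/

section LieInvolution

variable {K : Type*} [Group K] [TopologicalSpace K] {σ : K →ₜ* K}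

theorem conjPullback_apply (σ : K →ₜ* K) (f : repFun K) (x : K) :
    (conjPullback σ f).1 x = conj (f.1 (σ x)) := rfl

theorem conjPullback_smul (σ : K →ₜ* K) (c : ℂ) (f : repFun K) :
    conjPullback σ (c • f) = conj c • conjPullback σ f := by
  apply Subtype.ext; funext x
  simp [conjPullback_apply]

theorem conjPullback_conjPullback (hσ : Function.Involutive σ) (f : repFun K) :
    conjPullback σ (conjPullback σ f) = f := by
  apply Subtype.ext; funext x
  simp [conjPullback_apply, hσ x]

theorem conjPullback_leftTranslate (hσ : Function.Involutive σ) (a : K) (f : repFun K) :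
    conjPullback σ (leftTranslate a f) = leftTranslate (σ a) (conjPullback σ f) := by
  apply Subtype.ext; funext x
  change conj (f.1 (a * σ x)) = conj (f.1 (σ (σ a * x)))
  rw [map_mul, hσ a]

/-- The antilinear involution of `𝔨_ℂ` induced by `σ`. -/
def lieSigma (hσ : Function.Involutive σ) :
    complexLie K →ₛₗ[starRingEnd ℂ] complexLie K where
  toFun D := ⟨Derivation.mk'
    { toFun := fun f => conjPullback σ (D.1 (conjPullback σ f))
      map_add' := fun f g => by simp
      map_smul' := fun c f => by simp [conjPullback_smul] }
    fun f g => by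
      change conjPullback σ (D.1 (conjPullback σ (f * g))) =
        f * conjPullback σ (D.1 (conjPullback σ g)) + g * conjPullback σ (D.1 (conjPullback σ f))
      rw [map_mul, Derivation.leibniz, map_add, smul_eq_mul, smul_eq_mul, map_mul, map_mul,
        conjPullback_conjPullback hσ, conjPullback_conjPullback hσ], fun a f => by
      change conjPullback σ (D.1 (conjPullback σ (leftTranslate a f))) =
        leftTranslate a (conjPullback σ (D.1 (conjPullback σ f)))
      rw [conjPullback_leftTranslate hσ, D.2, conjPullback_leftTranslate hσ, hσ a]⟩
  map_add' D E := by
    apply Subtype.ext; ext1 f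
    exact map_add (conjPullback σ) _ _
  map_smul' c D := by
    apply Subtype.ext; ext1 f
    exact conjPullback_smul σ c _

theorem lieSigma_apply (hσ : Function.Involutive σ) (D : complexLie K) (f : repFun K) :
    (lieSigma hσ D).1 f = conjPullback σ (D.1 (conjPullback σ f)) := rfl

theorem lieSigma_lieSigma (hσ : Function.Involutive σ) (D : complexLie K) :
    lieSigma hσ (lieSigma hσ D) = D := by
  apply Subtype.ext; ext1 f
  rw [lieSigma_apply, lieSigma_apply, conjPullback_conjPullback hσ, conjPullback_conjPullback hσ]

theorem lieSigma_lie (hσ : Function.Involutive σ) (D E : complexLie K) :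
    lieSigma hσ ⁅D, E⁆ = ⁅lieSigma hσ D, lieSigma hσ E⁆ := by
  apply Subtype.ext; ext1 f
  rw [lieSigma_apply, LieSubalgebra.coe_bracket, LieSubalgebra.coe_bracket,
    Derivation.commutator_apply, Derivation.commutator_apply, map_sub]
  simp only [lieSigma_apply, conjPullback_conjPullback hσ]

theorem lieSigma_iterate (hσ : Function.Involutive σ) (D : complexLie K) (n : ℕ) (f : repFun K) :
    ((lieSigma hσ D).1)^[n] f = conjPullback σ ((D.1)^[n] (conjPullback σ f)) := by
  induction n with
  | zero => exact (conjPullback_conjPullback hσ f).symm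
  | succ n ih =>
    rw [Function.iterate_succ_apply', Function.iterate_succ_apply', ih, lieSigma_apply,
      conjPullback_conjPullback hσ]

/-- Conjugation is continuous and fixes the coefficients `1 / n!`, so Taylor's formula can be
conjugated term by term. -/
theorem IsExp.complexSigma (hσ : Function.Involutive σ) {D : complexLie K} {g : Complexification K}
    (h : IsExp D g) : IsExp (lieSigma hσ D) (complexSigma σ g) := by
  intro f
  rw [complexSigma_apply]
  refine ((h (conjPullback σ f)).map (starRingEnd ℂ) Complex.continuous_conj).congr_fun ?_
  intro n
  simp [lieSigma_iterate, conjPullback_apply]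

theorem complexSigma_one (σ : K →ₜ* K) : complexSigma σ (1 : Complexification K) = 1 := by
  ext f
  change conj (conj (f.1 (σ 1))) = f.1 1
  simp

theorem complexSigma_mul (hσ : Function.Involutive σ) (g h : Complexification K) :
    complexSigma σ (g * h) = complexSigma σ g * complexSigma σ h := by
  ext f
  rw [Complexification.mul_apply, complexSigma_apply, complexSigma_apply,
    Complexification.mul_apply]
  congr 2
  apply Subtype.ext; funext x
  change h (leftTranslate x (conjPullback σ f)) =
    conj (conj (h (conjPullback σ (leftTranslate (σ x) f))))
  rw [conjPullback_leftTranslate hσ, hσ x, Complex.conj_conj]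

theorem complexSigma_complexSigma (hσ : Function.Involutive σ) (g : Complexification K) :
    complexSigma σ (complexSigma σ g) = g := by
  ext f
  rw [complexSigma_apply, complexSigma_apply, conjPullback_conjPullback hσ, Complex.conj_conj]

/-- `complexSigma` as a group homomorphism. -/
def complexSigmaHom (hσ : Function.Involutive σ) : Complexification K →* Complexification K where
  toFun := complexSigma σ
  map_one' := complexSigma_one σ
  map_mul' := complexSigma_mul hσ

end LieInvolution

/-! ### Stability of root spaces and of the Borel subgroup. -/

section Borel

variable {K : Type*} [Group K] [TopologicalSpace K] {σ : K →ₜ* K} {T : Subgroup K}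

/-- Since `σ` maps `T` to itself, `conjPullback σ` preserves the ideal of functions vanishing on
`T`. -/
theorem lieSigma_mem_torusLie (hσ : Function.Involutive σ) (hσT : ∀ t ∈ T, σ t = t⁻¹)
    {D : complexLie K} (hD : D ∈ torusLie T) : lieSigma hσ D ∈ torusLie T := by
  intro f hf t ht
  rw [lieSigma_apply, conjPullback_apply, hσT t ht,
    hD (conjPullback σ f) (fun s hs => ?_) t⁻¹ (inv_mem ht), map_zero]
  rw [conjPullback_apply, hσT s hs, hf _ (inv_mem hs), map_zero]

/-- Elements of `𝔱_ℂ` act as scalars on the weight spaces of `T`. -/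
theorem exists_torusLie_apply_eq_smul {D : complexLie K} (hD : D ∈ torusLie T) (χ : T → ℂ) :
    ∃ a : ℂ, ∀ f ∈ weightSpace T.subtype χ, D.1 f = a • f := by
  by_cases h : ∀ f ∈ weightSpace T.subtype χ, f = 0
  · exact ⟨0, fun f hf => by rw [h f hf, map_zero, smul_zero]⟩
  push Not at h
  obtain ⟨f, hf, hf0⟩ := h
  obtain ⟨y, hy⟩ : ∃ y, f.1 y ≠ 0 := by
    by_contra! h
    exact hf0 (Subtype.ext (funext h))
  refine ⟨(D.1 f).1 y / f.1 y, fun g hg => ?_⟩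
  apply Subtype.ext; funext x
  -- At `t ∈ T` both terms equal `χ(t) f(y) g(x)`, so the combination vanishes on `T` and `D` of it
  -- vanishes at `1`. As `D` commutes with left translations, this says `f(y) (D g)(x) = g(x) (D
  -- f)(y)`.
  have h1 := hD (f.1 y • leftTranslate x g - g.1 x • leftTranslate y f) (fun t ht => by
    have h2 := hf y ⟨t, ht⟩
    have h3 := hg x ⟨t, ht⟩
    change f.1 y * g.1 (x * t) - g.1 x * f.1 (y * t) = 0
    simp only [Subgroup.subtype_apply] at h2 h3
    rw [h2, h3]
    ring) 1 (one_mem T)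
  rw [map_sub, Derivation.map_smul, Derivation.map_smul, D.2, D.2] at h1
  change f.1 y * (D.1 g).1 (x * 1) - g.1 x * (D.1 f).1 (y * 1) = 0 at h1
  rw [mul_one, mul_one] at h1
  change (D.1 g).1 x = (D.1 f).1 y / f.1 y * g.1 x
  field_simp
  linear_combination h1

variable [ContinuousMul K]

/-- `σ` replaces `t` by `t⁻¹`, and conjugation inverts the unimodular number `χ(t⁻¹)` back to
`χ(t)`. -/
theorem conjPullback_mem_weightSpace [CompactSpace T] (hσT : ∀ t ∈ T, σ t = t⁻¹) {χ : T → ℂ}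
    {f : repFun K} (hf : f ∈ weightSpace T.subtype χ) :
    conjPullback σ f ∈ weightSpace T.subtype χ := by
  by_cases hf0 : f = 0
  · rw [hf0, map_zero]; exact zero_mem _
  intro x t
  have h1 : χ t * χ t⁻¹ = 1 := by rw [← weight_mul hf hf0, mul_inv_cancel, weight_one hf hf0]
  have h2 : conj (χ t⁻¹) = χ t := by
    have h3 := norm_weight continuous_subtype_val hf hf0 t⁻¹
    have h4 : χ t⁻¹ * conj (χ t⁻¹) = 1 := by rw [Complex.mul_conj', h3]; simp
    have h5 : χ t⁻¹ ≠ 0 := right_ne_zero_of_mul_eq_one h1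
    exact mul_left_cancel₀ h5 (by rw [h4, mul_comm, h1])
  rw [conjPullback_apply, conjPullback_apply, map_mul, Subgroup.subtype_apply, hσT t t.2,
    ← h2, ← map_mul]
  exact congrArg conj (hf (σ x) t⁻¹)

/-- `R(K)` is spanned by common eigenvectors of `H ∈ 𝔱_ℂ` and of its image under `σ`, with
conjugate eigenvalues. Hence every eigenvector of the former is an eigenvector of the latter. -/
theorem lieSigma_apply_of_eigenvector [CompactSpace T] (hT : ∀ a b : T, a * b = b * a)
    (hσ : Function.Involutive σ) (hσT : ∀ t ∈ T, σ t = t⁻¹)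
    {D : complexLie K} (hD : D ∈ torusLie T) {a : ℂ} {f : repFun K} (hf : D.1 f = a • f) :
    (lieSigma hσ D).1 f = conj a • f := by
  let A : Module.End ℂ (repFun K) := D.1.toLinearMap
  let A' : Module.End ℂ (repFun K) := (lieSigma hσ D).1.toLinearMap
  let W : ℂ → Submodule ℂ (repFun K) := fun b => A.eigenspace b ⊓ A'.eigenspace (conj b)
  have hW : ⨆ b, W b = ⊤ := by
    rw [eq_top_iff, ← iSup_weightSpace_eq_top (φ := T.subtype) hT continuous_subtype_val]
    refine iSup_le fun χ => ?_
    obtain ⟨b, hb⟩ := exists_torusLie_apply_eq_smul hD χ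
    refine le_trans (fun g hg => ?_) (le_iSup W b)
    refine ⟨Module.End.mem_eigenspace_iff.mpr (hb g hg), Module.End.mem_eigenspace_iff.mpr ?_⟩
    change conjPullback σ (D.1 (conjPullback σ g)) = _
    rw [hb _ (conjPullback_mem_weightSpace hσT hg), conjPullback_smul,
      conjPullback_conjPullback hσ]
  -- The other `W b` lie in eigenspaces of `A` independent of that for `a`. As `W a` lies in the
  -- latter and all `W b` together span, the modular law leaves nothing outside `W a`.
  have hle : A.eigenspace a ≤ W a := by
    have hdisj : Disjoint (A.eigenspace a) (⨆ (b) (_ : b ≠ a), W b) :=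
      (A.eigenspaces_iSupIndep a).mono_right (iSup₂_mono fun b _ => inf_le_left)
    have hsup : W a ⊔ (⨆ (b) (_ : b ≠ a), W b) = ⊤ := by
      rw [← hW]
      exact (iSup_split_single W a).symm
    calc A.eigenspace a = (W a ⊔ ⨆ (b) (_ : b ≠ a), W b) ⊓ A.eigenspace a := by
          rw [hsup, top_inf_eq]
      _ = W a ⊔ (⨆ (b) (_ : b ≠ a), W b) ⊓ A.eigenspace a :=
          (sup_inf_assoc_of_le _ inf_le_left)
      _ ≤ W a := by rw [hdisj.symm.eq_bot, sup_bot_eq]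
  exact Module.End.mem_eigenspace_iff.mp (hle (Module.End.mem_eigenspace_iff.mpr hf)).2

/-- A root `α` satisfies `α(σ H) = conj (α(H))`. -/
theorem root_lieSigma [CompactSpace T] (hT : ∀ a b : T, a * b = b * a)
    (hσ : Function.Involutive σ) (hσT : ∀ t ∈ T, σ t = t⁻¹)
    {α : Module.Dual ℂ (torusLie T)} (hα : rootSpace T α ≠ ⊥) (H : torusLie T) :
    α ⟨lieSigma hσ H, lieSigma_mem_torusLie hσ hσT H.2⟩ = conj (α H) := by
  obtain ⟨X, hX, hX0⟩ := Submodule.exists_mem_ne_zero_of_ne_bot hα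
  -- Weight vectors are eigenvectors of `H` and span `R(K)`, so a nonzero `X` cannot kill all
  -- eigenvectors.
  obtain ⟨b, f, hf, hXf⟩ : ∃ (b : ℂ) (f : repFun K), H.1.1 f = b • f ∧ X.1 f ≠ 0 := by
    by_contra! hcon
    apply hX0
    apply Subtype.ext; ext1 f
    have hmem : f ∈ ⨆ χ : T → ℂ, weightSpace T.subtype χ :=
      (iSup_weightSpace_eq_top (φ := T.subtype) hT continuous_subtype_val).symm ▸
        Submodule.mem_top
    have hle : ⨆ χ : T → ℂ, weightSpace T.subtype χ ≤ LinearMap.ker X.1.toLinearMap := by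
      refine iSup_le fun χ g hg => ?_
      obtain ⟨b, hb⟩ := exists_torusLie_apply_eq_smul H.2 χ
      exact hcon b g (hb g hg)
    exact hle hmem
  have hbr : ∀ (H' : torusLie T) (c : ℂ), H'.1.1 f = c • f →
      H'.1.1 (X.1 f) = (α H' + c) • X.1 f := by
    intro H' c hc
    have h1 := congrArg (fun Y : complexLie K => Y.1 f) (hX H')
    change (⁅H'.1.1, X.1⁆ : Derivation ℂ (repFun K) (repFun K)) f = α H' • X.1 f at h1
    rw [Derivation.commutator_apply, hc, Derivation.map_smul] at h1
    rw [add_smul, ← h1, sub_add_cancel]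
  -- The eigenvalue of `σ H` on `X f ≠ 0` is computed twice: as the conjugate of `α(H) + b`, and as
  -- the shift of `conj b` by `α(σ H)`.
  have h1 := lieSigma_apply_of_eigenvector hT hσ hσT H.2 (hbr H b hf)
  have h2 := hbr ⟨lieSigma hσ H, lieSigma_mem_torusLie hσ hσT H.2⟩ (conj b)
    (lieSigma_apply_of_eigenvector hT hσ hσT H.2 hf)
  have h3 := smul_left_injective ℂ hXf (h2.symm.trans h1)
  simpa using h3

/-- Apply `σ` to `[σ H, X] = α(σ H) X`: antilinearity conjugates `α(σ H) = conj (α(H))` back to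
`α(H)`. -/
theorem lieSigma_mem_rootSpace [CompactSpace T] (hT : ∀ a b : T, a * b = b * a)
    (hσ : Function.Involutive σ) (hσT : ∀ t ∈ T, σ t = t⁻¹)
    {α : Module.Dual ℂ (torusLie T)} (hα : rootSpace T α ≠ ⊥) {X : complexLie K}
    (hX : X ∈ rootSpace T α) : lieSigma hσ X ∈ rootSpace T α := by
  intro H
  have h1 := hX ⟨lieSigma hσ H, lieSigma_mem_torusLie hσ hσT H.2⟩
  have h2 := congrArg (lieSigma hσ) h1
  rw [lieSigma_lie, LinearMap.map_smulₛₗ, root_lieSigma hT hσ hσT hα, Complex.conj_conj] at h2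
  simpa only [lieSigma_lieSigma] using h2

theorem lieSigma_mem_borelLie [CompactSpace T] (hT : ∀ a b : T, a * b = b * a)
    (hσ : Function.Involutive σ) (hσT : ∀ t ∈ T, σ t = t⁻¹)
    {P : Set (Module.Dual ℂ (torusLie T))} (hP : P ⊆ roots T) {D : complexLie K}
    (hD : D ∈ borelLie T P) : lieSigma hσ D ∈ borelLie T P := by
  have hle : borelLie T P ≤ (borelLie T P).comap (lieSigma hσ) := by
    refine sup_le (fun D hD => ?_) (iSup₂_le fun α hα X hX => ?_)
    · exact Submodule.mem_sup_left (lieSigma_mem_torusLie hσ hσT hD)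
    · exact Submodule.mem_sup_right (Submodule.mem_iSup_of_mem α (Submodule.mem_iSup_of_mem hα
        (lieSigma_mem_rootSpace hT hσ hσT (hP hα).2 hX)))
  exact hle hD

theorem complexSigma_mem_borel [CompactSpace T] (hT : ∀ a b : T, a * b = b * a)
    (hσ : Function.Involutive σ) (hσT : ∀ t ∈ T, σ t = t⁻¹)
    {P : Set (Module.Dual ℂ (torusLie T))} (hP : P ⊆ roots T) {g : Complexification K}
    (hg : g ∈ borel T P) : complexSigma σ g ∈ borel T P := by
  have hle : borel T P ≤ (borel T P).comap (complexSigmaHom hσ) := by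
    refine (Subgroup.closure_le _).mpr ?_
    rintro g ⟨D, hD, hg⟩
    exact Subgroup.subset_closure ⟨lieSigma hσ D, lieSigma_mem_borelLie hT hσ hσT hP hD,
      hg.complexSigma hσ⟩
  exact hle hg

end Borel

/-! ### The involution on loops, Bruhat cells and their closures. -/

section LoopInvolution

variable {K : Type*} [Group K] [TopologicalSpace K] {σ : K →ₜ* K}

theorem complexTau_mul (hσ : Function.Involutive σ) (f g : ℂˣ → Complexification K) :
    complexTau σ (f * g) = complexTau σ f * complexTau σ g := by
  funext z
  exact complexSigma_mul hσ _ _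

theorem complexTau_complexTau (hσ : Function.Involutive σ) (f : ℂˣ → Complexification K) :
    complexTau σ (complexTau σ f) = f := by
  funext z
  simp [complexTau, complexSigma_complexSigma hσ]

/-- Conjugating both the variable and the values preserves holomorphy, and the unit disk is stable
under conjugation. -/
theorem IsDiskExtension.complexTau {f : ℂˣ → Complexification K} {F : ℂ → Complexification K}
    (h : IsDiskExtension f F) :
    IsDiskExtension (complexTau σ f) fun z => complexSigma σ (F (conj z)) := by
  refine ⟨fun z => ?_, fun r z hz => ?_⟩
  · change complexSigma σ (F (conj (z : ℂ))) = complexSigma σ (f (star z))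
    rw [← h.1]
    rfl
  · have hz' : conj z ∈ Metric.ball (0 : ℂ) 1 := by simpa using hz
    have h1 := (h.2 (conjPullback σ r)).differentiableAt (Metric.isOpen_ball.mem_nhds hz')
    have h2 := h1.conj_conj
    rw [Complex.conj_conj] at h2
    exact h2.differentiableWithinAt

theorem complexTau_mem_posMaps {f : ℂˣ → Complexification K} (hf : f ∈ posMaps K) :
    complexTau σ f ∈ posMaps K := by
  obtain ⟨hf, F, hF⟩ := hf
  exact ⟨complexTau_mem σ hf, _, hF.complexTau⟩

theorem complexTau_mem_iwahori {B : Subgroup (Complexification K)}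
    (hB : ∀ g ∈ B, complexSigma σ g ∈ B) {f : ℂˣ → Complexification K} (hf : f ∈ iwahori B) :
    complexTau σ f ∈ iwahori B := by
  obtain ⟨hf, F, hF, hF0⟩ := hf
  refine ⟨complexTau_mem σ hf, _, hF.complexTau, ?_⟩
  rw [map_zero]
  exact hB _ hF0

theorem IsRestriction.complexTau {γ : Circle → K} {f : ℂˣ → Complexification K}
    (h : IsRestriction γ f) : IsRestriction (fun z => σ (γ z⁻¹)) (complexTau σ f) := by
  intro z
  have hz : star (Circle.toUnits z) = Circle.toUnits z⁻¹ := by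
    apply Units.ext
    exact (Circle.coe_inv_eq_conj z).symm
  rw [LoopGroup.complexTau, hz, h, complexSigma_toComplexification]

theorem tau_involutive (hσ : Function.Involutive σ) : Function.Involutive (tau (K := K) σ) := by
  intro γ
  apply Subtype.ext; funext z
  change σ (σ (γ.1 z⁻¹⁻¹)) = γ.1 z
  rw [hσ, inv_inv]

theorem sigma_coweight {T : Subgroup K} (hσT : ∀ t ∈ T, σ t = t⁻¹) (cow : Circle →ₜ* T)
    (z : Circle) : σ (cow z⁻¹) = cow z := by
  rw [hσT _ (cow z⁻¹).2, map_inv]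
  simp

theorem tau_mem_bruhatCell {T : Subgroup K} (hσ : Function.Involutive σ)
    (hσT : ∀ t ∈ T, σ t = t⁻¹) {B : Subgroup (Complexification K)}
    (hB : ∀ g ∈ B, complexSigma σ g ∈ B) {cow : Circle →ₜ* T} {γ : algLoops K}
    (hγ : γ ∈ bruhatCell B cow) : tau σ γ ∈ bruhatCell B cow := by
  obtain ⟨f, hf, l, hl, b, hb, p, hp, hγf, hcl, rfl⟩ := hγ
  refine ⟨_, complexTau_mem σ hf, _, complexTau_mem σ hl, _, complexTau_mem_iwahori hB hb, _,
    complexTau_mem_posMaps (σ := σ) hp, hγf.complexTau, ?_, ?_⟩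
  · simpa only [sigma_coweight hσT] using hcl.complexTau (σ := σ)
  · rw [complexTau_mul hσ, complexTau_mul hσ]

/-- In the angle, `z ↦ z⁻¹` is `θ ↦ -θ`; the sign it puts on derivatives and the conjugation both
disappear under the norm. -/
theorem h1Dist_conj_inv (u v : Circle → ℂ) :
    h1Dist (fun z => conj (u z⁻¹)) (fun z => conj (v z⁻¹)) = h1Dist u v := by
  -- No differentiability is needed: where it fails, both derivatives take the value `0`.
  have hderiv : ∀ (w : Circle → ℂ) (θ : ℝ),
      deriv (fun s : ℝ => conj (w (Circle.exp s)⁻¹)) θ =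
        -conj (deriv (fun s : ℝ => w (Circle.exp s)) (-θ)) := by
    intro w θ
    have h1 : (fun s : ℝ => conj (w (Circle.exp s)⁻¹)) =
        fun s => star ((fun s : ℝ => w (Circle.exp s)) (-s)) := by
      funext s
      simp [Circle.exp_neg]
    rw [h1, deriv.star, deriv_comp_neg (fun s : ℝ => w (Circle.exp s)), star_neg]
    rfl
  let g : ℝ → ℝ := fun θ => ‖u (Circle.exp θ) - v (Circle.exp θ)‖ ^ 2 +
    ‖deriv (fun s : ℝ => u (Circle.exp s)) θ - deriv (fun s : ℝ => v (Circle.exp s)) θ‖ ^ 2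
  -- Reflection moves the interval of integration to `[-2π, 0]`; periodicity moves it back.
  have hper : Function.Periodic g (2 * Real.pi) := by
    have hd : ∀ w : Circle → ℂ, Function.Periodic (deriv fun s : ℝ => w (Circle.exp s))
        (2 * Real.pi) := by
      intro w θ
      rw [← deriv_comp_add_const]
      simp only [Circle.exp_add_two_pi]
    intro θ
    simp only [g, Circle.exp_add_two_pi, hd u θ, hd v θ]
  have hint : ∀ θ : ℝ, ‖conj (u (Circle.exp θ)⁻¹) - conj (v (Circle.exp θ)⁻¹)‖ ^ 2 +
      ‖deriv (fun s : ℝ => conj (u (Circle.exp s)⁻¹)) θ -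
        deriv (fun s : ℝ => conj (v (Circle.exp s)⁻¹)) θ‖ ^ 2 = g (-θ) := by
    intro θ
    rw [hderiv, hderiv, ← map_sub, Complex.norm_conj, neg_sub_neg, ← map_sub, Complex.norm_conj,
      norm_sub_rev (deriv (fun s : ℝ => v (Circle.exp s)) (-θ)), ← Circle.exp_neg]
  have hflip : ∫ θ in (0 : ℝ)..(2 * Real.pi), g (-θ) = ∫ θ in (0 : ℝ)..(2 * Real.pi), g θ := by
    rw [intervalIntegral.integral_comp_neg]
    have := hper.intervalIntegral_add_eq (-(2 * Real.pi)) 0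
    simpa using this
  unfold h1Dist
  simp only [hint, hflip]
  rfl

/-- The preimage of the subbasic ball given by `r`, `γ₀`, `ε` is the ball given by `conjPullback σ
r`, `tau σ γ₀`, `ε`. -/
theorem continuous_tau (hσ : Function.Involutive σ) : Continuous (tau (K := K) σ) := by
  refine continuous_generateFrom_iff.mpr ?_
  rintro _ ⟨r, γ₀, ε, rfl⟩
  refine TopologicalSpace.isOpen_generateFrom_of_mem
    ⟨conjPullback σ r, tau σ γ₀, ε, ?_⟩
  ext γ
  change h1Dist (fun z => r.1 (σ (γ.1 z⁻¹))) (fun z => r.1 (γ₀.1 z)) < ε ↔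
    h1Dist (fun z => conj (r.1 (σ (γ.1 z)))) (fun z => conj (r.1 (σ (σ (γ₀.1 z⁻¹))))) < ε
  rw [← h1Dist_conj_inv]
  have h1 : ∀ z, σ (σ (γ₀.1 z)) = γ₀.1 z := fun z => hσ _
  simp only [h1, inv_inv]

theorem tau_image_closure (hσ : Function.Involutive σ) {S : Set (algLoops K)}
    (hS : ∀ γ ∈ S, tau σ γ ∈ S) : tau σ '' closure S = closure S := by
  have hle : tau σ '' closure S ⊆ closure S :=
    (image_closure_subset_closure_image (continuous_tau hσ)).trans
      (closure_mono (Set.image_subset_iff.mpr hS))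
  exact hle.antisymm fun γ hγ => ⟨tau σ γ, hle ⟨γ, hγ, rfl⟩, tau_involutive hσ γ⟩

end LoopInvolution

/-! ### Coweights are algebraic loops. -/

section Coweights

/-- The continuous characters of the circle are the powers `z ↦ zⁿ`. -/
theorem exists_zpow_of_circle_character {χ : Circle → ℂ} (hχ : Continuous χ) (h1 : χ 1 = 1)
    (hmul : ∀ z w, χ (z * w) = χ z * χ w) : ∃ n : ℤ, ∀ z, χ z = ((z ^ n : Circle) : ℂ) := by
  have : Fact ((0 : ℝ) < 1) := ⟨one_pos⟩
  let f : C(AddCircle (1 : ℝ), ℂ) := ⟨fun x => χ x.toCircle, hχ.comp AddCircle.continuous_toCircle⟩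
  -- If all coefficients vanished, the Fourier series would converge pointwise to `f` with sum `0`,
  -- contradicting `χ 1 = 1`.
  obtain ⟨n, hn⟩ : ∃ n, fourierCoeff f n ≠ 0 := by
    by_contra! h
    have h0 : fourierCoeff f = 0 := funext h
    have hs := has_pointwise_sum_fourier_series_of_summable (f := f)
      (by rw [h0]; exact summable_zero) 0
    simp only [h, zero_smul] at hs
    have h2 : f 0 = 0 := hs.unique hasSum_zero
    have h3 : f 0 = 1 := by
      change χ (AddCircle.toCircle 0) = 1
      rw [AddCircle.toCircle_zero, h1]
    exact one_ne_zero (h3.symm.trans h2)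
  refine ⟨n, fun z => ?_⟩
  obtain ⟨a, rfl⟩ : ∃ a : AddCircle (1 : ℝ), a.toCircle = z := by
    obtain ⟨a, ha⟩ := (AddCircle.homeomorphCircle (one_ne_zero (α := ℝ))).surjective z
    exact ⟨a, by rw [← AddCircle.homeomorphCircle_apply one_ne_zero, ha]⟩
  -- Translation by `a` leaves the integral unchanged but multiplies the integrand by this factor,
  -- which must then be `1`.
  have hshift : fourierCoeff f n = fourier (-n) a * χ a.toCircle * fourierCoeff f n := by
    conv_lhs => rw [fourierCoeff, ← MeasureTheory.integral_add_left_eq_self _ a]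
    rw [fourierCoeff, ← MeasureTheory.integral_const_mul]
    refine MeasureTheory.integral_congr_ae (Filter.Eventually.of_forall fun x => ?_)
    have h2 : (fourier (-n) (a + x) : ℂ) = fourier (-n) a * fourier (-n) x := by
      simp only [fourier_apply, smul_add, AddCircle.toCircle_add, Circle.coe_mul]
    have h3 : f (a + x) = χ a.toCircle * f x := by
      change χ (AddCircle.toCircle (a + x)) = χ a.toCircle * χ x.toCircle
      rw [AddCircle.toCircle_add, hmul]
    simp only [h2, h3, smul_eq_mul]
    ring
  have h2 : (fourier (-n) a : ℂ) * χ a.toCircle = 1 :=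
    mul_right_cancel₀ hn (by rw [one_mul]; exact hshift.symm)
  have h3 : (fourier (-n) a : ℂ) * ((a.toCircle ^ n : Circle) : ℂ) = 1 := by
    rw [fourier_apply, AddCircle.toCircle_zsmul, ← Circle.coe_mul, ← zpow_add, neg_add_cancel,
      zpow_zero, Circle.coe_one]
  exact mul_left_cancel₀ (left_ne_zero_of_mul_eq_one h2) (h2.trans h3.symm)

theorem zpow_mem_regularFun (n : ℤ) : (fun z : ℂˣ => ((z ^ n : ℂˣ) : ℂ)) ∈ regularFun := by
  cases n with
  | ofNat n =>
    have h : (fun z : ℂˣ => (z : ℂ)) ∈ regularFun := Algebra.subset_adjoin (Or.inl rfl)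
    convert regularFun.pow_mem h n using 1
    funext z
    simp
  | negSucc n =>
    have h : (fun z : ℂˣ => ((z⁻¹ : ℂˣ) : ℂ)) ∈ regularFun := Algebra.subset_adjoin (Or.inr rfl)
    convert regularFun.pow_mem h (n + 1) using 1
    funext z
    simp [zpow_negSucc]

/-- Clearing denominators lets the finiteness of the roots of a polynomial show that the circle
determines a regular function. -/
theorem exists_polynomial_of_mem_regularFun {p : ℂˣ → ℂ} (hp : p ∈ regularFun) :
    ∃ (N : ℕ) (q : Polynomial ℂ), ∀ z : ℂˣ, (z : ℂ) ^ N * p z = q.eval (z : ℂ) := by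
  induction hp using Algebra.adjoin_induction with
  | mem p hp =>
    rcases hp with rfl | rfl
    · exact ⟨0, Polynomial.X, fun z => by simp⟩
    · exact ⟨1, 1, fun z => by simp⟩
  | algebraMap c => exact ⟨0, Polynomial.C c, fun z => by simp⟩
  | add p q _ _ hp hq =>
    obtain ⟨N, P, hP⟩ := hp
    obtain ⟨M, Q, hQ⟩ := hq
    refine ⟨N + M, Polynomial.X ^ M * P + Polynomial.X ^ N * Q, fun z => ?_⟩
    simp only [Polynomial.eval_add, Polynomial.eval_mul, Polynomial.eval_pow, Polynomial.eval_X,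
      ← hP, ← hQ, Pi.add_apply]
    ring
  | mul p q _ _ hp hq =>
    obtain ⟨N, P, hP⟩ := hp
    obtain ⟨M, Q, hQ⟩ := hq
    refine ⟨N + M, P * Q, fun z => ?_⟩
    simp only [Polynomial.eval_mul, ← hP, ← hQ, Pi.mul_apply]
    ring

theorem infinite_range_circle_coe : (Set.range ((↑) : Circle → ℂ)).Infinite := by
  have hinj : Set.InjOn Circle.exp (Set.Icc 0 1) :=
    Circle.exp_injOn_Icc (by linarith [Real.pi_gt_three])
  refine ((Set.Icc_infinite (zero_lt_one (α := ℝ))).image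
    (Circle.coe_injective.comp_injOn hinj)).mono ?_
  rintro _ ⟨x, -, rfl⟩
  exact ⟨Circle.exp x, rfl⟩

/-- A regular function on `ℂˣ` is determined by its restriction to the circle. -/
theorem eq_of_eqOn_circle {p q : ℂˣ → ℂ} (hp : p ∈ regularFun) (hq : q ∈ regularFun)
    (h : ∀ z : Circle, p (Circle.toUnits z) = q (Circle.toUnits z)) : p = q := by
  obtain ⟨N, Q, hQ⟩ := exists_polynomial_of_mem_regularFun (regularFun.sub_mem hp hq)
  have hQ0 : Q = 0 := by
    refine Polynomial.eq_zero_of_infinite_isRoot Q (infinite_range_circle_coe.mono ?_)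
    rintro _ ⟨z, rfl⟩
    have := hQ (Circle.toUnits z)
    rw [Pi.sub_apply, h z, sub_self, mul_zero] at this
    exact this.symm
  funext z
  have h1 := hQ z
  rw [hQ0, Polynomial.eval_zero] at h1
  exact sub_eq_zero.mp ((mul_eq_zero.mp h1).resolve_left (pow_ne_zero _ z.ne_zero))

variable {K : Type*} [Group K] [TopologicalSpace K] [ContinuousMul K]

/-- The condition is linear in `f`, so weight vectors suffice; for weight `zⁿ` the restriction is
`f(1) zⁿ`. -/
theorem exists_regularFun_restriction (cow : Circle →* K) (hcow : Continuous cow) (f : repFun K) :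
    ∃ p ∈ regularFun, ∀ z : Circle, p (Circle.toUnits z) = f.1 (cow z) := by
  let S : Submodule ℂ (repFun K) :=
    { carrier := {f | ∃ p ∈ regularFun, ∀ z : Circle, p (Circle.toUnits z) = f.1 (cow z)}
      add_mem' := fun ⟨p, hp, h⟩ ⟨q, hq, h'⟩ =>
        ⟨p + q, regularFun.add_mem hp hq, fun z => congrArg₂ (· + ·) (h z) (h' z)⟩
      zero_mem' := ⟨0, regularFun.zero_mem, fun z => rfl⟩
      smul_mem' := fun c f ⟨p, hp, h⟩ =>
        ⟨c • p, regularFun.smul_mem hp c, fun z => congrArg (c * ·) (h z)⟩ }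
  suffices hS : ⨆ χ : Circle → ℂ, weightSpace cow χ ≤ S by
    rw [iSup_weightSpace_eq_top mul_comm hcow] at hS
    exact hS Submodule.mem_top
  refine iSup_le fun χ g hg => ?_
  by_cases hg0 : g = 0
  · rw [hg0]; exact S.zero_mem
  obtain ⟨n, hn⟩ := exists_zpow_of_circle_character (continuous_weight hcow hg hg0)
    (weight_one hg hg0) (weight_mul hg hg0)
  refine ⟨g.1 1 • fun z : ℂˣ => ((z ^ n : ℂˣ) : ℂ),
    regularFun.smul_mem (zpow_mem_regularFun n) _, fun z => ?_⟩
  have h := hg 1 z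
  rw [one_mul, hn] at h
  rw [h, Pi.smul_apply, smul_eq_mul, ← map_zpow, mul_comm]
  rfl

/-- A continuous homomorphism `S¹ → K` extends to an algebraic map `ℂˣ → K_ℂ`. -/
theorem exists_algMaps_restriction (cow : Circle →* K) (hcow : Continuous cow) :
    ∃ l ∈ algMaps K, IsRestriction cow l := by
  choose p hp hpc using exists_regularFun_restriction cow hcow
  -- Extensions from the circle are unique, so the chosen `p` is automatically an algebra
  -- homomorphism; evaluating it at `z` gives a point of `K_ℂ`.
  have huniq : ∀ (f : repFun K) (q : ℂˣ → ℂ), q ∈ regularFun →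
      (∀ z : Circle, q (Circle.toUnits z) = f.1 (cow z)) → p f = q := fun f q hq h =>
    eq_of_eqOn_circle (hp f) hq fun z => by rw [hpc, h]
  let P : repFun K →ₐ[ℂ] (ℂˣ → ℂ) :=
    { toFun := p
      map_one' := huniq 1 1 regularFun.one_mem fun z => rfl
      map_mul' := fun f g => huniq _ _ (regularFun.mul_mem (hp f) (hp g)) fun z =>
        congrArg₂ (· * ·) (hpc f z) (hpc g z)
      map_zero' := huniq 0 0 regularFun.zero_mem fun z => rfl
      map_add' := fun f g => huniq _ _ (regularFun.add_mem (hp f) (hp g)) fun z =>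
        congrArg₂ (· + ·) (hpc f z) (hpc g z)
      commutes' := fun c => huniq _ _ (regularFun.algebraMap_mem c) fun z => rfl }
  refine ⟨fun z => (Pi.evalAlgHom ℂ (fun _ : ℂˣ => ℂ) z).comp P, fun r => hp r, fun z => ?_⟩
  ext r
  exact hpc r z

theorem coweight_mem_algLoops {T : Subgroup K} (cow : Circle →ₜ* T) :
    (fun z => (cow z : K)) ∈ algLoops K := by
  refine ⟨by simp, ?_⟩
  exact exists_algMaps_restriction (T.subtype.comp cow.toMonoidHom)
    (continuous_subtype_val.comp cow.continuous_toFun)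

end Coweights

theorem IsTorus.compactSpace {K : Type*} [Group K] [TopologicalSpace K] {T : Subgroup K}
    (hT : IsTorus T) : CompactSpace T := by
  obtain ⟨n, ⟨e⟩⟩ := hT
  exact e.toHomeomorph.symm.compactSpace

theorem IsTorus.mul_comm {K : Type*} [Group K] [TopologicalSpace K] {T : Subgroup K}
    (hT : IsTorus T) (a b : T) : a * b = b * a := by
  obtain ⟨n, ⟨e⟩⟩ := hT
  exact e.injective (by rw [map_mul, map_mul, _root_.mul_comm])

end LoopGroup

end

theorem proposition4p3 {E : Type*} [NormedAddCommGroup E] [NormedSpace ℝ E] [FiniteDimensional ℝ E]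
    {K : Type*} [TopologicalSpace K] [ChartedSpace E K] [Group K] [LieGroup 𝓘(ℝ, E) ∞ K]
    [T2Space K] [CompactSpace K] [SimplyConnectedSpace K]
    (T : Subgroup K) (hT : LoopGroup.IsMaximalTorus T)
    (P : Set (Module.Dual ℂ (LoopGroup.torusLie T))) (hP : LoopGroup.IsPositiveSystem T P)
    (σ : K →ₜ* K) (hσ : Function.Involutive σ) (hσT : ∀ t ∈ T, σ t = t⁻¹) :
    -- the Borel subgroup and the Iwahori subgroup are stable under the involution
    LoopGroup.complexSigma σ '' (LoopGroup.borel T P) = LoopGroup.borel T P ∧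
    LoopGroup.complexTau σ '' (LoopGroup.iwahori (LoopGroup.borel T P)) =
      LoopGroup.iwahori (LoopGroup.borel T P) ∧
    -- each coweight is an element of `Ω_alg K` that is fixed by the involution
    (∀ cow : Circle →ₜ* T, ∃ γ : LoopGroup.algLoops K,
      (∀ z, γ.1 z = cow z) ∧ LoopGroup.tau σ γ = γ) ∧
    -- each Schubert variety is invariant under the involution
    (∀ cow : Circle →ₜ* T,
      LoopGroup.tau σ '' LoopGroup.schubertVariety (LoopGroup.borel T P) cow =
        LoopGroup.schubertVariety (LoopGroup.borel T P) cow) := by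
  have : IsTopologicalGroup K := topologicalGroup_of_lieGroup 𝓘(ℝ, E) ∞
  have : CompactSpace T := hT.1.compactSpace
  have hB : ∀ g ∈ LoopGroup.borel T P, LoopGroup.complexSigma σ g ∈ LoopGroup.borel T P :=
    fun g hg => LoopGroup.complexSigma_mem_borel hT.1.mul_comm hσ hσT hP.subset_roots hg
  refine ⟨?_, ?_, fun cow => ?_, fun cow => ?_⟩
  -- For an involution, mapping a set into itself already means mapping it onto itself.
  · exact (Set.image_subset_iff.mpr hB).antisymm fun g hg =>
      ⟨_, hB g hg, LoopGroup.complexSigma_complexSigma hσ g⟩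
  · exact (Set.image_subset_iff.mpr fun f hf =>
      LoopGroup.complexTau_mem_iwahori hB hf).antisymm fun f hf =>
      ⟨_, LoopGroup.complexTau_mem_iwahori hB hf, LoopGroup.complexTau_complexTau hσ f⟩
  · refine ⟨⟨_, LoopGroup.coweight_mem_algLoops cow⟩, fun _ => rfl, ?_⟩
    apply Subtype.ext
    funext z
    exact LoopGroup.sigma_coweight hσT cow z
  · exact LoopGroup.tau_image_closure hσ fun γ hγ => LoopGroup.tau_mem_bruhatCell hσ hσT hB hγ
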